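/- For $n\ge 1$ let $B_n$ be the braid group on $n$ strands, $b\mapsto\rho_b$ the quotient map $B_n\to S_n$ (the strand numbered $k$ at the bottom of $b$ is numbered $\rho_b(k)$ at the top), and $PB_n$ its kernel. For $1\le k\le n$ let $\kappa_k^n\colon B_n\to B_{n+1}$ be the cloning map, which bifurcates the $k$th strand, numbered at the bottom, into two parallel strands; it restricts to a homomorphism $PB_n\to PB_{n+1}$. Trees are finite rooted binary trees, and $T\cup\lambda_k$ is $T$ with a caret attached to its $k$th leaf. Let $V_{br}$ be the braided Thompson group: its elements are the triples $(T_-,b,T_+)$, where $T_\pm$ are trees with $n$ leaves and $b\in B_n$ for some $n$, modulo the equivalence relation generated by the expansions $$(T_-,b,T_+)\sim(T_-\cup\lambda_{\rho_b(k)},\,\kappa_k^n(b),\,T_+\cup\lambda_k),$$ with the product determined by $(T,a,S)(S,b,U)=(T,ab,U)$. Let $F_{br}\le V_{br}$ be the subgroup of the elements $(T_-,p,T_+)$ with $p$ pure, and $P_{br}\le F_{br}$ the subgroup of the elements $(T,p,T)$ with $p$ pure. For a tree $T$ with $n$ leaves let $PB_{n,T}$ be a copy of $PB_n$ and $\iota_{n,T}\colon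 PB_{n,T}\to P_{br}$, $p\mapsto(T,p,T)$. Write $(n,T)\le(n',T')$ if $T'$ is obtained from $T$ by successively attaching carets to leaves; the corresponding composition of cloning maps is a homomorphism $\kappa\colon PB_{n,T}\to PB_{n',T'}$. A family of subgroups $G_{n,T}\le PB_{n,T}$ is coherent if $\kappa(G_{n,T})\subseteq G_{n',T'}$ whenever $(n,T)\le(n',T')$, and it is complete if moreover $\kappa^{-1}(G_{n',T'})=G_{n,T}$ for all such pairs. (1) Let $(G_{n,T})_{n,T}$ be a complete coherent family of subgroups $G_{n,T}\le PB_{n,T}$, and let $G\le P_{br}$ be the subgroup generated by all the $\iota_{n,T}(G_{n,T})$. Then $G$ is normal in $F_{br}$ if and only if each $G_{n,T}$ is normal in $PB_{n,T}$ and, for every $n$ and all trees $T,S$ with $n$ leaves, $G_{n,T}=G_{n,S}$ as subgroups of $PB_n$. (2) Let $(G_n)_n$ be a sequence of subgroups $G_n\le PB_n$ such that $\kappa_k^n(PB_n)\cap G_{n+1}=\kappa_k^n(G_n)$ for all $1\le k\le n$, and let $G_{\mathrm{Th}}\le P_{br}$ be the subgroup generated by all the $\iota_{n,T}(G_n)$,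 where $T$ runs over the trees with $n$ leaves. If each $G_n$ is normal in $PB_n$, then $G_{\mathrm{Th}}$ is normal in $F_{br}$. Moreover, $G_{\mathrm{Th}}$ is normal in $V_{br}$ if and only if each $G_n$ is normal in $B_n$. -/

import Mathlib

namespace BraidedThompson

/-! ### Braid groups -/

/-- Artin's relators: `σᵢσⱼ = σⱼσᵢ` for `|i - j| ≥ 2` and `σᵢσᵢ₊₁σᵢ = σᵢ₊₁σᵢσᵢ₊₁`. The generators
are numbered from `0`, and `σᵢ` crosses the strands in the positions `i` and `i + 1`. -/
def braidRels (n : ℕ) : Set (FreeGroup (Fin (n - 1))) :=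
  {r | ∃ i j : Fin (n - 1), i.val + 2 ≤ j.val ∧
      r = FreeGroup.of i * FreeGroup.of j * (FreeGroup.of j * FreeGroup.of i)⁻¹} ∪
  {r | ∃ i j : Fin (n - 1), i.val + 1 = j.val ∧
      r = FreeGroup.of i * FreeGroup.of j * FreeGroup.of i *
        (FreeGroup.of j * FreeGroup.of i * FreeGroup.of j)⁻¹}

/-- The braid group `Bₙ` on `n` strands. -/
abbrev Braid (n : ℕ) : Type := PresentedGroup (braidRels n)

/-- The generator `σᵢ` of `Bₙ`, and `1` if there is none of this number. -/
def gen (n i : ℕ) : Braid n :=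
  if h : i < n - 1 then PresentedGroup.of ⟨i, h⟩ else 1

theorem gen_eq_of {n : ℕ} (i : Fin (n - 1)) : gen n i.val = PresentedGroup.of i := by
  simp [gen]

theorem gen_comm {n i j : ℕ} (h : i + 2 ≤ j) : gen n i * gen n j = gen n j * gen n i := by
  unfold gen
  split_ifs with h1 h2 h2
  · exact PresentedGroup.mk_eq_mk_of_mul_inv_mem (Or.inl ⟨⟨i, h1⟩, ⟨j, h2⟩, h, rfl⟩)
  all_goals simp

theorem gen_braid {n i : ℕ} (h : i + 2 < n) :
    gen n i * gen n (i + 1) * gen n i = gen n (i + 1) * gen n i * gen n (i + 1) := by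
  unfold gen
  rw [dif_pos (show i < n - 1 by omega), dif_pos (show i + 1 < n - 1 by omega)]
  exact PresentedGroup.mk_eq_mk_of_mul_inv_mem
    (Or.inr ⟨⟨i, by omega⟩, ⟨i + 1, by omega⟩, rfl, rfl⟩)

theorem gen_braid' {n i : ℕ} (h : i + 2 < n) (x : Braid n) :
    gen n i * (gen n (i + 1) * (gen n i * x)) =
      gen n (i + 1) * (gen n i * (gen n (i + 1) * x)) := by
  rw [← mul_assoc, ← mul_assoc, gen_braid h]; simp only [mul_assoc]

theorem gen_comm' {n i j : ℕ} (h : i + 2 ≤ j) (x : Braid n) :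
    gen n i * (gen n j * x) = gen n j * (gen n i * x) := by
  rw [← mul_assoc, gen_comm h, mul_assoc]

/-- A homomorphism out of `Bₙ`, given on generators that satisfy the braid relations. -/
def braidLift {n : ℕ} {H : Type*} [Group H] (f : Fin (n - 1) → H)
    (h₁ : ∀ i j : Fin (n - 1), i.val + 2 ≤ j.val → f i * f j = f j * f i)
    (h₂ : ∀ i j : Fin (n - 1), i.val + 1 = j.val → f i * f j * f i = f j * f i * f j) :
    Braid n →* H :=
  PresentedGroup.toGroup (f := f) (by
    rintro r (⟨i, j, hij, rfl⟩ | ⟨i, j, hij, rfl⟩)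
    · simpa [mul_inv_eq_one, mul_assoc] using mul_inv_eq_one.2 (h₁ i j hij)
    · simpa [mul_inv_eq_one, mul_assoc] using mul_inv_eq_one.2 (h₂ i j hij))

theorem braidLift_of {n : ℕ} {H : Type*} [Group H] (f : Fin (n - 1) → H) (h₁ h₂)
    (i : Fin (n - 1)) : braidLift f h₁ h₂ (PresentedGroup.of i) = f i :=
  PresentedGroup.toGroup.of _

theorem braid_induction {n : ℕ} {P : Braid n → Prop} (b : Braid n) (one : P 1)
    (hgen : ∀ i, i < n - 1 → P (gen n i)) (mul : ∀ a b, P a → P b → P (a * b))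
    (inv : ∀ a, P a → P a⁻¹) : P b := by
  have hb : b ∈ Subgroup.closure (Set.range (PresentedGroup.of (rels := braidRels n))) := by
    rw [PresentedGroup.closure_range_of]; trivial
  induction hb using Subgroup.closure_induction with
  | mem x hx =>
    obtain ⟨i, rfl⟩ := hx
    rw [← gen_eq_of]; exact hgen _ i.isLt
  | one => exact one
  | mul x y _ _ hx hy => exact mul _ _ hx hy
  | inv x _ hx => exact inv _ hx

/-- `swapNat i` exchanges `i` and `i + 1`. -/
def swapNat (i k : ℕ) : ℕ := if k = i then i + 1 else if k = i + 1 then i else k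

theorem swapNat_lt {i k : ℕ} (h : k < i) : swapNat i k = k := by unfold swapNat; grind

theorem swapNat_self (i : ℕ) : swapNat i i = i + 1 := by unfold swapNat; grind

theorem swapNat_succ {i k : ℕ} (h : k = i + 1) : swapNat i k = i := by unfold swapNat; grind

theorem swapNat_gt {i k : ℕ} (h : i + 1 < k) : swapNat i k = k := by unfold swapNat; grind

theorem position_cases (k i : ℕ) : k < i ∨ k = i ∨ k = i + 1 ∨ i + 1 < k := by omega

theorem swapNat_far {i j : ℕ} (k : ℕ) (h : i + 2 ≤ j) :
    swapNat i (swapNat j k) = swapNat j (swapNat i k) := by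
  unfold swapNat; grind

theorem swapNat_braid (i k : ℕ) :
    swapNat i (swapNat (i + 1) (swapNat i k)) =
      swapNat (i + 1) (swapNat i (swapNat (i + 1) k)) := by
  unfold swapNat; grind

/-- The transposition of the positions `i` and `i + 1`. -/
def adjSwap {n : ℕ} (i : Fin (n - 1)) : Equiv.Perm (Fin n) :=
  Equiv.swap ⟨i.val, by omega⟩ ⟨i.val + 1, by omega⟩

theorem adjSwap_val {n : ℕ} (i : Fin (n - 1)) (k : Fin n) :
    (adjSwap i k).val = swapNat i.val k.val := by
  unfold adjSwap swapNat
  rw [Equiv.swap_apply_def]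
  simp only [Fin.ext_iff]
  split_ifs <;> rfl

theorem adjSwap_far {n : ℕ} (i j : Fin (n - 1)) (h : i.val + 2 ≤ j.val) :
    adjSwap i * adjSwap j = adjSwap j * adjSwap i := by
  ext k
  simpa only [Equiv.Perm.mul_apply, adjSwap_val] using swapNat_far k.val h

theorem adjSwap_braid {n : ℕ} (i j : Fin (n - 1)) (h : i.val + 1 = j.val) :
    adjSwap i * adjSwap j * adjSwap i = adjSwap j * adjSwap i * adjSwap j := by
  ext k
  simpa only [Equiv.Perm.mul_apply, adjSwap_val, ← h] using swapNat_braid i.val k.val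

/-- The quotient map `b ↦ ρ_b` from `Bₙ` to `Sₙ`. Positions are numbered from the left, from `0`;
the strand that is in the position `k` at the bottom of `b` is in the position `ρ_b(k)` at the top,
and `a * b` is `a` stacked on top of `b`. -/
def rho {n : ℕ} : Braid n →* Equiv.Perm (Fin n) :=
  braidLift adjSwap adjSwap_far adjSwap_braid

theorem rho_gen_val {n i : ℕ} (h : i < n - 1) (k : Fin n) :
    (rho (gen n i) k).val = swapNat i k.val := by
  rw [gen_eq_of ⟨i, h⟩, rho, braidLift_of, adjSwap_val]

/-- The pure braid group `PBₙ`. -/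
def PureBraid (n : ℕ) : Subgroup (Braid n) := (rho (n := n)).ker

/-! ### Cloning -/

section Words

variable {H : Type*} [Group H] {a b c : H}

theorem word_aux₁ (h₁ : a * b * a = b * a * b) (h₂ : b * c * b = c * b * c) (h : a * c = c * a) :
    a * b * (c * (a * b)) = b * c * (a * b * c) := by
  calc a * b * (c * (a * b)) = a * b * (c * a) * b := by simp only [mul_assoc]
    _ = a * b * a * (c * b) := by rw [← h]; simp only [mul_assoc]
    _ = b * a * (b * c * b) := by rw [h₁]; simp only [mul_assoc]
    _ = b * (a * c) * (b * c) := by rw [h₂]; simp only [mul_assoc]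
    _ = b * c * (a * b * c) := by rw [h]; simp only [mul_assoc]

theorem word_aux₂ (h₁ : a * b * a = b * a * b) (h₂ : b * c * b = c * b * c) (h : a * c = c * a) :
    a * b * (c * (b * a)) = c * b * (a * (b * c)) := by
  calc a * b * (c * (b * a)) = a * (b * c * b) * a := by simp only [mul_assoc]
    _ = a * c * b * (c * a) := by rw [h₂]; simp only [mul_assoc]
    _ = (a * c) * b * (a * c) := by rw [← h]
    _ = c * (a * b * a) * c := by rw [show a * c * b * (a * c) = (a * c) * (b * a * c) by simp only [mul_assoc], h]; simp only [mul_assoc]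
    _ = c * b * (a * (b * c)) := by rw [h₁]; simp only [mul_assoc]

theorem word_aux₃ (h₁ : a * b * a = b * a * b) (h₂ : b * c * b = c * b * c) (h : a * c = c * a) :
    b * a * (c * (b * a)) = c * b * (a * (c * b)) := by
  calc b * a * (c * (b * a)) = b * (a * c) * (b * a) := by simp only [mul_assoc]
    _ = b * c * (a * b * a) := by rw [h]; simp only [mul_assoc]
    _ = b * c * b * (a * b) := by rw [h₁]; simp only [mul_assoc]
    _ = c * b * (c * a) * b := by rw [h₂]; simp only [mul_assoc]
    _ = c * b * (a * (c * b)) := by rw [← h]; simp only [mul_assoc]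

end Words

/-- The braid on `n + 1` strands obtained from `σᵢ` by bifurcating the strand which is in the
position `k` at the bottom. -/
def cloneGen (n k i : ℕ) : Braid (n + 1) :=
  if k < i then gen (n + 1) (i + 1)
  else if k = i then gen (n + 1) i * gen (n + 1) (i + 1)
  else if k = i + 1 then gen (n + 1) (i + 1) * gen (n + 1) i
  else gen (n + 1) i

theorem cloneGen_lt {n i k : ℕ} (h : k < i) : cloneGen n k i = gen (n + 1) (i + 1) := by
  unfold cloneGen; rw [if_pos h]

theorem cloneGen_self {n i : ℕ} : cloneGen n i i = gen (n + 1) i * gen (n + 1) (i + 1) := by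
  unfold cloneGen; rw [if_neg (by omega), if_pos rfl]

theorem cloneGen_succ {n i k : ℕ} (h : k = i + 1) :
    cloneGen n k i = gen (n + 1) (i + 1) * gen (n + 1) i := by
  unfold cloneGen; rw [if_neg (by omega), if_neg (by omega), if_pos h]

theorem cloneGen_gt {n i k : ℕ} (h : i + 1 < k) : cloneGen n k i = gen (n + 1) i := by
  unfold cloneGen; rw [if_neg (by omega), if_neg (by omega), if_neg (by omega)]

theorem cloneGen_far {n i j : ℕ} (k : ℕ) (h : i + 2 ≤ j) :
    cloneGen n (swapNat j k) i * cloneGen n k j =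
      cloneGen n (swapNat i k) j * cloneGen n k i := by
  have f1 := gen_comm (n := n + 1) (i := i) (j := j) h
  have f2 := gen_comm (n := n + 1) (i := i) (j := j + 1) (by omega)
  have f3 := gen_comm (n := n + 1) (i := i + 1) (j := j + 1) (by omega)
  have c1 := gen_comm' (n := n + 1) (i := i) (j := j) h
  have c2 := gen_comm' (n := n + 1) (i := i) (j := j + 1) (by omega)
  have c3 := gen_comm' (n := n + 1) (i := i + 1) (j := j + 1) (by omega)
  rcases position_cases k i with hk | rfl | rfl | hk
  · simp (disch := omega) only [swapNat_lt, cloneGen_lt, f3]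
  · simp (disch := omega) only [swapNat_lt, swapNat_self, cloneGen_lt, cloneGen_self, mul_assoc,
      c2, f3]
  · simp (disch := omega) only [swapNat_lt, swapNat_succ, cloneGen_lt, cloneGen_succ, mul_assoc,
      f2, c3]
  · rcases position_cases k j with hk' | rfl | rfl | hk'
    · simp (disch := omega) only [swapNat_lt, swapNat_gt, cloneGen_gt, cloneGen_lt, f2]
    · simp (disch := omega) only [swapNat_self, swapNat_gt, cloneGen_gt, cloneGen_self, mul_assoc,
        c1, f2]
    · simp (disch := omega) only [swapNat_succ, swapNat_gt, cloneGen_gt, cloneGen_succ, mul_assoc,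
        f1, c2]
    · simp (disch := omega) only [swapNat_gt, cloneGen_gt, f1]

theorem cloneGen_braid {n i : ℕ} (k : ℕ) (h : i + 2 < n) :
    cloneGen n (swapNat (i + 1) (swapNat i k)) i * cloneGen n (swapNat i k) (i + 1) *
        cloneGen n k i =
      cloneGen n (swapNat i (swapNat (i + 1) k)) (i + 1) * cloneGen n (swapNat (i + 1) k) i *
        cloneGen n k (i + 1) := by
  have f1 := gen_braid (n := n + 1) (i := i) (by omega)
  have f2 := gen_braid (n := n + 1) (i := i + 1) (by omega)
  have c1 := gen_comm (n := n + 1) (i := i) (j := i + 1 + 1) (by omega)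
  rcases position_cases k i with hk | rfl | rfl | hk
  · simp (disch := omega) only [swapNat_lt, cloneGen_lt, f2]
  · simp (disch := omega) only [swapNat_lt, swapNat_self, cloneGen_gt, cloneGen_lt, cloneGen_self]
    simpa only [mul_assoc] using word_aux₁ f1 f2 c1
  · simp (disch := omega) only [swapNat_lt, swapNat_self, swapNat_succ, swapNat_gt, cloneGen_gt,
      cloneGen_lt, cloneGen_self, cloneGen_succ]
    simpa only [mul_assoc] using word_aux₂ f1 f2 c1
  · rcases eq_or_lt_of_le (show i + 1 + 1 ≤ k from hk) with rfl | hk'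
    · simp (disch := omega) only [swapNat_succ, swapNat_gt, cloneGen_gt, cloneGen_lt,
        cloneGen_succ]
      simpa only [mul_assoc] using word_aux₃ f1 f2 c1
    · simp (disch := omega) only [swapNat_gt, cloneGen_gt, f1]

/-- The permutation `(g, k) ↦ (κ_k(σᵢ) g, ρ_{σᵢ}(k))` of `Bₙ₊₁ × {0, …, n - 1}`. -/
def cloneActGen {n : ℕ} (i : Fin (n - 1)) : Equiv.Perm (Braid (n + 1) × Fin n) where
  toFun x := (cloneGen n x.2.val i.val * x.1, adjSwap i x.2)
  invFun x := ((cloneGen n (adjSwap i x.2).val i.val)⁻¹ * x.1, adjSwap i x.2)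
  left_inv x := by simp [adjSwap]
  right_inv x := by simp [adjSwap]

/-- The action `b • (g, k) = (κ_k(b) g, ρ_b(k))` of `Bₙ` on `Bₙ₊₁ × {0, …, n - 1}` through which
the cloning maps are defined. That it is an action amounts to
`κ_k(a b) = κ_{ρ_b(k)}(a) κ_k(b)`. -/
def cloneAct {n : ℕ} : Braid n →* Equiv.Perm (Braid (n + 1) × Fin n) :=
  braidLift cloneActGen
    (by
      intro i j hij
      ext1 x
      refine Prod.ext ?_ (DFunLike.congr_fun (adjSwap_far i j hij) x.2)
      have := cloneGen_far (n := n) x.2.val hij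
      simp only [Equiv.Perm.mul_apply, cloneActGen, Equiv.coe_fn_mk, adjSwap_val]
      rw [← mul_assoc, ← mul_assoc, this])
    (by
      intro i j hij
      ext1 x
      refine Prod.ext ?_ (DFunLike.congr_fun (adjSwap_braid i j hij) x.2)
      have := cloneGen_braid (n := n) (i := i.val) x.2.val (by omega)
      simp only [Equiv.Perm.mul_apply, cloneActGen, Equiv.coe_fn_mk, adjSwap_val, ← hij]
      rw [← mul_assoc, ← mul_assoc, ← mul_assoc, ← mul_assoc, this])

/-- The cloning map `κ_k : Bₙ → Bₙ₊₁`, which bifurcates into two parallel strands the strand that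
is in the position `k` at the bottom. It is determined by `clone_gen`, `clone_one` and
`clone_mul`. -/
def clone {n : ℕ} (k : Fin n) (b : Braid n) : Braid (n + 1) := (cloneAct b (1, k)).1

theorem cloneAct_apply {n : ℕ} (b : Braid n) :
    ∀ (g : Braid (n + 1)) (k : Fin n), cloneAct b (g, k) = (clone k b * g, rho b k) := by
  unfold clone
  induction b using braid_induction with
  | one => simp
  | hgen i hi =>
    intro g k
    rw [gen_eq_of ⟨i, hi⟩]
    simp [cloneAct, rho, braidLift_of, cloneActGen]
  | mul a b ha hb =>
    intro g k
    simp only [map_mul, Equiv.Perm.mul_apply]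
    rw [hb g, ha, hb 1, ha (_ * 1)]
    simp [mul_assoc]
  | inv a ha =>
    intro g k
    have key : ∀ (g : Braid (n + 1)) (k : Fin n), cloneAct a⁻¹ (g, k) =
        ((cloneAct a (1, (rho a)⁻¹ k)).1⁻¹ * g, (rho a)⁻¹ k) := by
      intro g k
      rw [map_inv, Equiv.Perm.inv_eq_iff_eq, ha]
      simp
    rw [key, key 1]
    simp

theorem clone_mul {n : ℕ} (k : Fin n) (a b : Braid n) :
    clone k (a * b) = clone (rho b k) a * clone k b := by
  conv_lhs => unfold clone
  rw [map_mul, Equiv.Perm.mul_apply, cloneAct_apply, cloneAct_apply]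
  simp

theorem clone_one {n : ℕ} (k : Fin n) : clone k (1 : Braid n) = 1 := by
  simp [clone]

theorem clone_gen {n : ℕ} (k : Fin n) (i : Fin (n - 1)) :
    clone k (PresentedGroup.of i : Braid n) = cloneGen n k.val i.val := by
  simp [clone, cloneAct, braidLift_of, cloneActGen]

theorem clone_inv {n : ℕ} (k : Fin n) (a : Braid n) :
    clone k a⁻¹ = (clone ((rho a)⁻¹ k) a)⁻¹ := by
  rw [eq_inv_iff_mul_eq_one, ← clone_one ((rho a)⁻¹ k), ← inv_mul_cancel a, clone_mul]
  simp

/-- After the bifurcation of the strand in the position `j`, the strand that was in the position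
`k ≠ j` is in the position `shift j k`. -/
def shift {n : ℕ} (j k : Fin n) : Fin (n + 1) := if j < k then k.succ else k.castSucc

theorem shift_val_lt {n : ℕ} {j k : Fin n} (h : j.val < k.val) : (shift j k).val = k.val + 1 := by
  unfold shift; rw [if_pos (Fin.lt_def.2 h)]; rfl

theorem shift_val_gt {n : ℕ} {j k : Fin n} (h : k.val < j.val) : (shift j k).val = k.val := by
  unfold shift; rw [if_neg (by rw [Fin.lt_def]; omega)]; rfl

theorem clone_gen' {n i : ℕ} (k : Fin n) (h : i < n - 1) :
    clone k (gen n i) = cloneGen n k.val i := by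
  rw [gen_eq_of ⟨i, h⟩, clone_gen]

theorem rho_gen_mul_val {n i j : ℕ} (hi : i < n - 1) (hj : j < n - 1) (k : Fin n) :
    (rho (gen n i * gen n j) k).val = swapNat i (swapNat j k.val) := by
  rw [map_mul, Equiv.Perm.mul_apply, rho_gen_val hi, rho_gen_val hj]

theorem clone_gen_mul {n i j : ℕ} (hi : i < n - 1) (hj : j < n - 1) (k : Fin n) :
    clone k (gen n i * gen n j) = cloneGen n (swapNat j k.val) i * cloneGen n k.val j := by
  rw [clone_mul, clone_gen' _ hi, clone_gen' _ hj, rho_gen_val hj]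

theorem rho_clone_gen_val {n i : ℕ} (j : Fin n) (hi : i < n - 1) (k : Fin (n + 1)) :
    (rho (clone j (gen n i)) k).val =
      if j.val < i then swapNat (i + 1) k.val
      else if j.val = i then swapNat i (swapNat (i + 1) k.val)
      else if j.val = i + 1 then swapNat (i + 1) (swapNat i k.val)
      else swapNat i k.val := by
  rw [clone_gen' j hi]
  unfold cloneGen
  split_ifs
  · rw [rho_gen_val (by omega)]
  · rw [rho_gen_mul_val (by omega) (by omega)]
  · rw [rho_gen_mul_val (by omega) (by omega)]
  · rw [rho_gen_val (by omega)]

theorem rho_clone_shift {n : ℕ} (b : Braid n) : ∀ j k : Fin n, j ≠ k →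
    rho (clone j b) (shift j k) = shift (rho b j) (rho b k) := by
  induction b using braid_induction with
  | one => intro j k _; simp [clone_one]
  | hgen i hi =>
    intro j k hjk
    apply Fin.ext
    have hjk' : j.val ≠ k.val := fun h => hjk (Fin.ext h)
    rw [rho_clone_gen_val j hi]
    unfold shift
    simp only [apply_ite Fin.val, Fin.val_succ, Fin.val_castSucc, Fin.lt_def, rho_gen_val hi]
    unfold swapNat
    grind
  | mul a b ha hb =>
    intro j k hjk
    rw [clone_mul, map_mul, Equiv.Perm.mul_apply, hb j k hjk,
      ha _ _ ((rho b).injective.ne hjk), map_mul, Equiv.Perm.mul_apply, Equiv.Perm.mul_apply]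
  | inv a ha =>
    intro j k hjk
    rw [clone_inv, map_inv, Equiv.Perm.inv_eq_iff_eq, map_inv,
      ha _ _ ((rho a)⁻¹.injective.ne hjk)]
    simp

theorem rho_clone_left {n : ℕ} (b : Braid n) : ∀ j : Fin n,
    rho (clone j b) j.castSucc = (rho b j).castSucc := by
  induction b using braid_induction with
  | one => intro j; simp [clone_one]
  | hgen i hi =>
    intro j
    apply Fin.ext
    rw [rho_clone_gen_val j hi]
    simp only [Fin.val_castSucc, rho_gen_val hi]
    unfold swapNat
    grind
  | mul a b ha hb =>
    intro j
    rw [clone_mul, map_mul, Equiv.Perm.mul_apply, hb, ha, map_mul, Equiv.Perm.mul_apply]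
  | inv a ha =>
    intro j
    rw [clone_inv, map_inv, Equiv.Perm.inv_eq_iff_eq, map_inv, ha]
    simp

theorem rho_clone_right {n : ℕ} (b : Braid n) : ∀ j : Fin n,
    rho (clone j b) j.succ = (rho b j).succ := by
  induction b using braid_induction with
  | one => intro j; simp [clone_one]
  | hgen i hi =>
    intro j
    apply Fin.ext
    rw [rho_clone_gen_val j hi]
    simp only [Fin.val_succ, rho_gen_val hi]
    unfold swapNat
    grind
  | mul a b ha hb =>
    intro j
    rw [clone_mul, map_mul, Equiv.Perm.mul_apply, hb, ha, map_mul, Equiv.Perm.mul_apply]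
  | inv a ha =>
    intro j
    rw [clone_inv, map_inv, Equiv.Perm.inv_eq_iff_eq, map_inv, ha]
    simp

theorem clone_clone_gen {n i : ℕ} (hi : i < n - 1) (j k : Fin n) (h : j.val < k.val) :
    clone (shift j k) (clone j (gen n i)) = clone (shift k j) (clone k (gen n i)) := by
  have e1 : (shift j k).val = k.val + 1 := shift_val_lt h
  have e2 : (shift k j).val = j.val := shift_val_gt h
  rw [clone_gen' j hi, clone_gen' k hi]
  obtain ⟨j, hj⟩ := j
  obtain ⟨k, hk⟩ := k
  simp only at h e1 e2 ⊢
  have c2 := gen_comm' (n := n + 1 + 1) (i := i) (j := i + 1 + 1) (by omega)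
  have d1 : k < i ∨ k = i ∨ k = i + 1 ∨ i + 1 < k := position_cases k i
  rcases position_cases j i with hji | rfl | rfl | hji <;>
  rcases d1 with hki | rfl | rfl | hki <;>
  first
  | omega
  | simp (disch := omega) only [swapNat_lt, swapNat_self, swapNat_succ, swapNat_gt, cloneGen_gt,
      cloneGen_lt, cloneGen_self, cloneGen_succ, clone_gen', clone_gen_mul, e1, e2, mul_assoc,
      c2]

/-- Bifurcations of two different strands commute. -/
theorem clone_clone {n : ℕ} (b : Braid n) : ∀ j k : Fin n, j ≠ k →
    clone (shift j k) (clone j b) = clone (shift k j) (clone k b) := by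
  induction b using braid_induction with
  | one => intro j k _; simp [clone_one]
  | hgen i hi =>
    intro j k hjk
    rcases lt_or_gt_of_ne (fun h => hjk (Fin.ext h) : j.val ≠ k.val) with h | h
    · exact clone_clone_gen hi j k h
    · exact (clone_clone_gen hi k j h).symm
  | mul a b ha hb =>
    intro j k hjk
    rw [clone_mul, clone_mul, rho_clone_shift b j k hjk, hb j k hjk,
      ha _ _ ((rho b).injective.ne hjk), clone_mul k, clone_mul (shift k j),
      rho_clone_shift b k j hjk.symm]
  | inv a ha =>
    intro j k hjk
    have h := (rho a)⁻¹.injective.ne hjk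
    have e : ∀ j k : Fin n, j ≠ k →
        (rho (clone ((rho a)⁻¹ j) a))⁻¹ (shift j k) = shift ((rho a)⁻¹ j) ((rho a)⁻¹ k) := by
      intro j k hjk
      rw [Equiv.Perm.inv_eq_iff_eq, rho_clone_shift a _ _ ((rho a)⁻¹.injective.ne hjk)]
      simp
    rw [clone_inv j, clone_inv, e j k hjk, ha _ _ h, clone_inv k, clone_inv, e k j hjk.symm]

/-! ### Trees -/

/-- The finite rooted binary trees with `n` leaves. -/
def LeafTree (n : ℕ) : Type := {T : BinaryTree Unit // T.numLeaves = n}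

/-- The tree obtained by attaching a caret to the leaf number `k`; the leaves are numbered from the
left, from `0`. -/
def graftCaret : BinaryTree Unit → ℕ → BinaryTree Unit
  | .nil, _ => .node () .nil .nil
  | .node _ l r, k =>
    if k < l.numLeaves then .node () (graftCaret l k) r
    else .node () l (graftCaret r (k - l.numLeaves))

theorem numLeaves_graftCaret (T : BinaryTree Unit) :
    ∀ k, (graftCaret T k).numLeaves = T.numLeaves + 1 := by
  induction T with
  | nil => intro k; rfl
  | node _ l r hl hr =>
    intro k
    unfold graftCaret
    split_ifs
    · simp only [BinaryTree.numLeaves, hl]; omega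
    · simp only [BinaryTree.numLeaves, hr]; omega

/-- The tree `T ∪ λ_k`, obtained by attaching a caret to the leaf number `k` of `T`. -/
def LeafTree.addCaret {n : ℕ} (T : LeafTree n) (k : Fin n) : LeafTree (n + 1) :=
  ⟨graftCaret T.1 k.val, by rw [numLeaves_graftCaret, T.2]⟩

theorem graftCaret_comm (T : BinaryTree Unit) : ∀ j k, j < k → k < T.numLeaves →
    graftCaret (graftCaret T j) (k + 1) = graftCaret (graftCaret T k) j := by
  induction T with
  | nil => intro j k h1 h2; simp only [BinaryTree.numLeaves] at h2; omega
  | node _ l r hl hr =>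
    intro j k h1 h2
    simp only [BinaryTree.numLeaves] at h2
    by_cases hk : k < l.numLeaves
    · simp only [graftCaret, hk, show j < l.numLeaves by omega, if_true, numLeaves_graftCaret,
        show k + 1 < l.numLeaves + 1 by omega, show j < l.numLeaves + 1 by omega]
      rw [hl j k h1 hk]
    · by_cases hj : j < l.numLeaves
      · simp only [graftCaret, hk, hj, if_true, if_false, numLeaves_graftCaret,
          show ¬ k + 1 < l.numLeaves + 1 by omega]
        rw [show k + 1 - (l.numLeaves + 1) = k - l.numLeaves by omega]
      · simp only [graftCaret, hk, hj, if_false, show ¬ k + 1 < l.numLeaves by omega]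
        rw [show k + 1 - l.numLeaves = k - l.numLeaves + 1 by omega,
          hr _ _ (by omega) (by omega)]

theorem LeafTree.addCaret_comm {n : ℕ} (T : LeafTree n) (j k : Fin n) (h : j ≠ k) :
    (T.addCaret j).addCaret (shift j k) = (T.addCaret k).addCaret (shift k j) := by
  apply Subtype.ext
  have hk := k.isLt
  have hj := j.isLt
  rcases lt_or_gt_of_ne (fun e => h (Fin.ext e) : j.val ≠ k.val) with h | h
  · simp only [LeafTree.addCaret, shift_val_lt h, shift_val_gt h]
    exact graftCaret_comm _ _ _ h (by rw [T.2]; exact hk)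
  · simp only [LeafTree.addCaret, shift_val_lt h, shift_val_gt h]
    exact (graftCaret_comm _ _ _ h (by rw [T.2]; exact hj)).symm

/-- `S` is obtained from `T` by attaching trees to leaves. -/
def TreeLE : BinaryTree Unit → BinaryTree Unit → Prop
  | .nil, _ => True
  | .node _ _ _, .nil => False
  | .node _ l r, .node _ l' r' => TreeLE l l' ∧ TreeLE r r'

theorem TreeLE.refl (T : BinaryTree Unit) : TreeLE T T := by
  induction T with
  | nil => trivial
  | node _ l r hl hr => exact ⟨hl, hr⟩

theorem TreeLE.trans {T S U : BinaryTree Unit} (h : TreeLE T S) (h' : TreeLE S U) :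
    TreeLE T U := by
  induction T generalizing S U with
  | nil => trivial
  | node _ l r hl hr =>
    cases S with
    | nil => exact h.elim
    | node _ l' r' =>
      cases U with
      | nil => exact h'.elim
      | node _ l'' r'' => exact ⟨hl h.1 h'.1, hr h.2 h'.2⟩

theorem TreeLE.graftCaret_right (T : BinaryTree Unit) : ∀ k, TreeLE T (graftCaret T k) := by
  induction T with
  | nil => intro k; trivial
  | node _ l r hl hr =>
    intro k
    unfold graftCaret
    split_ifs
    · exact ⟨hl _, TreeLE.refl r⟩
    · exact ⟨TreeLE.refl l, hr _⟩

theorem TreeLE.numLeaves_le {T S : BinaryTree Unit} (h : TreeLE T S) :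
    T.numLeaves ≤ S.numLeaves := by
  induction T generalizing S with
  | nil => exact S.numLeaves_pos
  | node _ l r hl hr =>
    cases S with
    | nil => exact h.elim
    | node _ l' r' => exact Nat.add_le_add (hl h.1) (hr h.2)

theorem TreeLE.graftCaret_graftCaret {T W : BinaryTree Unit} : ∀ j k, j < k → k < T.numLeaves →
    TreeLE (graftCaret T j) W → TreeLE (graftCaret T k) W →
    TreeLE (graftCaret (graftCaret T j) (k + 1)) W := by
  induction T generalizing W with
  | nil => intro j k h1 h2; simp only [BinaryTree.numLeaves] at h2; omega
  | node _ l r hl hr =>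
    intro j k h1 h2 h3 h4
    simp only [BinaryTree.numLeaves] at h2
    cases W with
    | nil =>
      unfold graftCaret at h3
      split_ifs at h3 <;> exact h3.elim
    | node _ l' r' =>
      by_cases hk : k < l.numLeaves
      · simp only [graftCaret, hk, show j < l.numLeaves by omega, if_true, numLeaves_graftCaret,
          show k + 1 < l.numLeaves + 1 by omega] at h3 h4 ⊢
        exact ⟨hl j k h1 hk h3.1 h4.1, h3.2⟩
      · by_cases hj : j < l.numLeaves
        · simp only [graftCaret, hk, hj, if_true, if_false, numLeaves_graftCaret,
            show ¬ k + 1 < l.numLeaves + 1 by omega] at h3 h4 ⊢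
          rw [show k + 1 - (l.numLeaves + 1) = k - l.numLeaves by omega]
          exact ⟨h3.1, h4.2⟩
        · simp only [graftCaret, hk, hj, if_false, show ¬ k + 1 < l.numLeaves by omega]
            at h3 h4 ⊢
          rw [show k + 1 - l.numLeaves = k - l.numLeaves + 1 by omega]
          exact ⟨h3.1, hr _ _ (by omega) (by omega) h3.2 h4.2⟩

theorem LeafTree.addCaret_le {n : ℕ} (T : LeafTree n) (W : BinaryTree Unit) (j k : Fin n)
    (h : j ≠ k) (hj : TreeLE (T.addCaret j).1 W) (hk : TreeLE (T.addCaret k).1 W) :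
    TreeLE ((T.addCaret j).addCaret (shift j k)).1 W := by
  have hk' := k.isLt
  have hj' := j.isLt
  rcases lt_or_gt_of_ne (fun e => h (Fin.ext e) : j.val ≠ k.val) with h' | h'
  · simp only [LeafTree.addCaret, shift_val_lt h']
    exact TreeLE.graftCaret_graftCaret _ _ h' (by rw [T.2]; exact hk') hj hk
  · rw [LeafTree.addCaret_comm T j k h]
    simp only [LeafTree.addCaret, shift_val_lt h']
    exact TreeLE.graftCaret_graftCaret _ _ h' (by rw [T.2]; exact hj') hk hj

theorem TreeLE.eq_or_exists {T W : BinaryTree Unit} (h : TreeLE T W) :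
    T = W ∨ ∃ k, k < T.numLeaves ∧ TreeLE (graftCaret T k) W := by
  induction T generalizing W with
  | nil =>
    cases W with
    | nil => exact Or.inl rfl
    | node _ l' r' => exact Or.inr ⟨0, Nat.one_pos, trivial, trivial⟩
  | node _ l r hl hr =>
    cases W with
    | nil => exact h.elim
    | node _ l' r' =>
      rcases hl h.1 with rfl | ⟨k, hk, hk'⟩
      · rcases hr h.2 with rfl | ⟨k, hk, hk'⟩
        · exact Or.inl rfl
        · refine Or.inr ⟨l.numLeaves + k, by simp only [BinaryTree.numLeaves]; omega, ?_⟩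
          simp only [graftCaret, show ¬ l.numLeaves + k < l.numLeaves by omega, if_false,
            Nat.add_sub_cancel_left]
          exact ⟨h.1, hk'⟩
      · refine Or.inr ⟨k, by simp only [BinaryTree.numLeaves]; omega, ?_⟩
        simp only [graftCaret, hk, if_true]
        exact ⟨hk', h.2⟩

theorem TreeLE.exists_upper (T S : BinaryTree Unit) : ∃ W, TreeLE T W ∧ TreeLE S W := by
  induction T generalizing S with
  | nil => exact ⟨S, trivial, TreeLE.refl S⟩
  | node _ l r hl hr =>
    cases S with
    | nil => exact ⟨_, TreeLE.refl _, trivial⟩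
    | node _ l' r' =>
      obtain ⟨W₁, h1, h2⟩ := hl l'
      obtain ⟨W₂, h3, h4⟩ := hr r'
      exact ⟨.node () W₁ W₂, ⟨h1, h3⟩, ⟨h2, h4⟩⟩

/-! ### Braided paired tree diagrams -/

/-- A braided paired tree diagram `(T₋, b, T₊)`. -/
structure Diagram where
  n : ℕ
  top : LeafTree n
  braid : Braid n
  bot : LeafTree n

/-- The expansion `(T₋ ∪ λ_{ρ_b(k)}, κ_k(b), T₊ ∪ λ_k)` of `(T₋, b, T₊)`. -/
def Diagram.expand (x : Diagram) (k : Fin x.n) : Diagram where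
  n := x.n + 1
  top := x.top.addCaret (rho x.braid k)
  braid := clone k x.braid
  bot := x.bot.addCaret k

/-- `y` is an expansion of `x`. -/
def Expansion (x y : Diagram) : Prop := ∃ k : Fin x.n, y = x.expand k

/-- The underlying set of the braided Thompson group: the braided paired tree diagrams up to the
equivalence relation that is generated by the expansions. -/
def Vbr : Type := Quot Expansion

/-- The element of the braided Thompson group that is represented by `(T, b, S)`. -/
def Vbr.mk {n : ℕ} (T : LeafTree n) (b : Braid n) (S : LeafTree n) : Vbr :=
  Quot.mk Expansion ⟨n, T, b, S⟩

/-- `y` is obtained from `x` by finitely many expansions. -/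
def Expands : Diagram → Diagram → Prop := Relation.ReflTransGen Expansion

theorem Diagram.expand_expand (x : Diagram) (j k : Fin x.n) (h : j ≠ k) :
    (x.expand j).expand (shift j k) = (x.expand k).expand (shift k j) := by
  obtain ⟨n, T, b, S⟩ := x
  have e : ∀ {m : ℕ} {T T' S S' : LeafTree m} {b b' : Braid m}, T = T' → b = b' → S = S' →
      Diagram.mk m T b S = Diagram.mk m T' b' S' := by
    rintro m T _ S _ b _ rfl rfl rfl; rfl
  have hT : (T.addCaret (rho b j)).addCaret (rho (clone j b) (shift j k)) =
      (T.addCaret (rho b k)).addCaret (rho (clone k b) (shift k j)) := by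
    rw [rho_clone_shift _ _ _ h, rho_clone_shift _ _ _ (Ne.symm h),
      LeafTree.addCaret_comm _ _ _ ((rho b).injective.ne h)]
  exact e hT (clone_clone b j k h) (S.addCaret_comm j k h)

theorem quot_eq_iff (x y : Diagram) : Quot.mk Expansion x = Quot.mk Expansion y ↔
    ∃ z, Expands x z ∧ Expands y z := by
  have hcr : ∀ a b c, Expansion a b → Expansion a c →
      ∃ d, Relation.ReflGen Expansion b d ∧ Relation.ReflTransGen Expansion c d := by
    rintro a _ _ ⟨j, rfl⟩ ⟨k, rfl⟩
    by_cases h : j = k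
    · subst h; exact ⟨_, .refl, .refl⟩
    · exact ⟨_, .single ⟨shift j k, rfl⟩, .single ⟨shift k j, a.expand_expand j k h⟩⟩
  constructor
  · intro h
    have h := Quot.eqvGen_exact h
    have heq := Relation.equivalence_join_reflTransGen hcr
    have key : ∀ {x y}, Relation.EqvGen Expansion x y →
        Relation.Join (Relation.ReflTransGen Expansion) x y := by
      intro x y h
      induction h with
      | rel x y h => exact ⟨y, .single h, .refl⟩
      | refl x => exact heq.refl x
      | symm x y _ ih => exact heq.symm ih
      | trans x y z _ _ ih₁ ih₂ => exact heq.trans ih₁ ih₂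
    exact key h
  · have key : ∀ x z, Expands x z → Quot.mk Expansion x = Quot.mk Expansion z := by
      intro x z h
      induction h with
      | refl => rfl
      | tail _ h ih => exact ih.trans (Quot.sound h)
    rintro ⟨z, hx, hy⟩
    rw [key x z hx, key y z hy]

theorem Expands.quot_eq {x y : Diagram} (h : Expands x y) :
    Quot.mk Expansion x = Quot.mk Expansion y :=
  (quot_eq_iff x y).2 ⟨y, h, .refl⟩

theorem Expands.bot_le {x y : Diagram} (h : Expands x y) : TreeLE x.bot.1 y.bot.1 := by
  induction h with
  | refl => exact TreeLE.refl _
  | tail _ h ih =>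
    obtain ⟨k, rfl⟩ := h
    exact ih.trans (TreeLE.graftCaret_right _ _)

theorem Expands.top_le {x y : Diagram} (h : Expands x y) : TreeLE x.top.1 y.top.1 := by
  induction h with
  | refl => exact TreeLE.refl _
  | tail _ h ih =>
    obtain ⟨k, rfl⟩ := h
    exact ih.trans (TreeLE.graftCaret_right _ _)

theorem Expands.eq_or_lt {x y : Diagram} (h : Expands x y) : x = y ∨ x.n < y.n := by
  induction h with
  | refl => exact Or.inl rfl
  | tail _ h ih =>
    obtain ⟨k, rfl⟩ := h
    right
    simp only [Diagram.expand]
    rcases ih with rfl | ih <;> omega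

theorem Expands.expand_of_top_le {y Y : Diagram} (h : Expands y Y) : ∀ j : Fin y.n,
    TreeLE (y.top.addCaret j).1 Y.top.1 → Expands (y.expand ((rho y.braid)⁻¹ j)) Y := by
  induction h using Relation.ReflTransGen.head_induction_on with
  | refl =>
    intro j hj
    have := hj.numLeaves_le
    rw [(Y.top.addCaret j).2, Y.top.2] at this
    omega
  | @head y y' hy h ih =>
    obtain ⟨i, rfl⟩ := hy
    intro j hj
    by_cases hij : i = (rho y.braid)⁻¹ j
    · rw [← hij]; exact h
    · have hij' : rho y.braid i ≠ j := by
        rintro rfl; simp at hij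
      have h1 := ih (shift (rho y.braid i) j)
        (y.top.addCaret_le _ _ _ hij' (Expands.top_le h) hj)
      have h2 : (rho (clone i y.braid))⁻¹ (shift (rho y.braid i) j) =
          shift i ((rho y.braid)⁻¹ j) := by
        rw [Equiv.Perm.inv_eq_iff_eq, rho_clone_shift _ _ _ hij]
        simp
      have h3 : Expands ((y.expand i).expand (shift i ((rho y.braid)⁻¹ j))) Y := h2 ▸ h1
      rw [y.expand_expand _ _ hij] at h3
      exact .head ⟨_, rfl⟩ h3

theorem exists_expands_bot (x : Diagram) (W : BinaryTree Unit) (h : TreeLE x.bot.1 W) :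
    ∃ y, Expands x y ∧ y.bot.1 = W := by
  obtain ⟨d, hd⟩ : ∃ d, W.numLeaves - x.n = d := ⟨_, rfl⟩
  induction d using Nat.strong_induction_on generalizing x with
  | _ d ih =>
    rcases h.eq_or_exists with h' | ⟨k, hk, hk'⟩
    · exact ⟨x, .refl, h'⟩
    · rw [x.bot.2] at hk
      have hle := hk'.numLeaves_le
      rw [numLeaves_graftCaret, x.bot.2] at hle
      obtain ⟨y, hy, hW⟩ := ih (W.numLeaves - (x.n + 1)) (by omega) (x.expand ⟨k, hk⟩) hk' rfl
      exact ⟨y, .head ⟨_, rfl⟩ hy, hW⟩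

theorem exists_expands_top (x : Diagram) (W : BinaryTree Unit) (h : TreeLE x.top.1 W) :
    ∃ y, Expands x y ∧ y.top.1 = W := by
  obtain ⟨d, hd⟩ : ∃ d, W.numLeaves - x.n = d := ⟨_, rfl⟩
  induction d using Nat.strong_induction_on generalizing x with
  | _ d ih =>
    rcases h.eq_or_exists with h' | ⟨k, hk, hk'⟩
    · exact ⟨x, .refl, h'⟩
    · rw [x.top.2] at hk
      have hle := hk'.numLeaves_le
      rw [numLeaves_graftCaret, x.top.2] at hle
      obtain ⟨y, hy, hW⟩ := ih (W.numLeaves - (x.n + 1)) (by omega)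
        (x.expand ((rho x.braid)⁻¹ ⟨k, hk⟩))
        (by simpa [Diagram.expand, LeafTree.addCaret] using hk') rfl
      exact ⟨y, .head ⟨_, rfl⟩ hy, hW⟩

/-- Two diagrams can be expanded until they can be stacked. -/
theorem exists_match (x y : Diagram) : ∃ (m : ℕ) (T S U : LeafTree m) (a b : Braid m),
    Expands x ⟨m, T, a, S⟩ ∧ Expands y ⟨m, S, b, U⟩ := by
  obtain ⟨W, h1, h2⟩ := TreeLE.exists_upper x.bot.1 y.top.1
  obtain ⟨⟨m, T, a, S⟩, hX, rfl⟩ := exists_expands_bot x W h1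
  obtain ⟨⟨m', S', b, U⟩, hY, hS⟩ := exists_expands_top y _ h2
  obtain rfl : m' = m := by rw [← S'.2, ← S.2]; exact congrArg _ hS
  obtain rfl : S' = S := Subtype.ext hS
  exact ⟨m', T, S', U, a, b, hX, hY⟩

theorem expands_stack {m : ℕ} {T' S' U' : LeafTree m} {a' b' : Braid m} {x : Diagram}
    (hx : Expands x ⟨m, T', a', S'⟩) : ∀ {n : ℕ} (T S U : LeafTree n) (a b : Braid n),
    x = ⟨n, T, a, S⟩ → Expands ⟨n, S, b, U⟩ ⟨m, S', b', U'⟩ →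
    Vbr.mk T (a * b) U = Vbr.mk T' (a' * b') U' := by
  induction hx using Relation.ReflTransGen.head_induction_on with
  | refl =>
    intro n T S U a b hx hy
    cases hx
    rcases hy.eq_or_lt with h | h
    · cases h; rfl
    · exact absurd h (lt_irrefl _)
  | @head x x' hx h ih =>
    intro n T S U a b hx' hy
    subst hx'
    obtain ⟨k, rfl⟩ := hx
    have h1 := hy.expand_of_top_le k (Expands.bot_le h)
    have hk : rho b ((rho b)⁻¹ k) = k := by simp
    have h2 := ih (T.addCaret (rho a k)) (S.addCaret k) (U.addCaret ((rho b)⁻¹ k))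
      (clone k a) (clone ((rho b)⁻¹ k) b) rfl (by simpa only [Diagram.expand, hk] using h1)
    rw [← h2]
    refine (Quot.sound ⟨(rho b)⁻¹ k, ?_⟩)
    simp only [Diagram.expand, clone_mul, map_mul, Equiv.Perm.mul_apply, hk]

theorem mk_mul_unique {n m : ℕ} {T S U : LeafTree n} {T' S' U' : LeafTree m} {a b : Braid n}
    {a' b' : Braid m} (h₁ : Vbr.mk T a S = Vbr.mk T' a' S')
    (h₂ : Vbr.mk S b U = Vbr.mk S' b' U') :
    Vbr.mk T (a * b) U = Vbr.mk T' (a' * b') U' := by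
  obtain ⟨X, hX, hX'⟩ := (quot_eq_iff _ _).1 h₁
  obtain ⟨Y, hY, hY'⟩ := (quot_eq_iff _ _).1 h₂
  obtain ⟨l, T₂, S₂, U₂, a₂, b₂, hX₂, hY₂⟩ := exists_match X Y
  rw [expands_stack (hX.trans hX₂) T S U a b rfl (hY.trans hY₂),
    expands_stack (hX'.trans hX₂) T' S' U' a' b' rfl (hY'.trans hY₂)]

/-- The product of two elements, which is defined by stacking diagrams. -/
theorem exists_product (x y : Vbr) : ∃ z : Vbr, ∀ (n : ℕ) (T S U : LeafTree n) (a b : Braid n),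
    x = Vbr.mk T a S → y = Vbr.mk S b U → z = Vbr.mk T (a * b) U := by
  induction x using Quot.ind with | _ x =>
  induction y using Quot.ind with | _ y =>
  obtain ⟨m, T, S, U, a, b, hx, hy⟩ := exists_match x y
  refine ⟨Vbr.mk T (a * b) U, fun n T' S' U' a' b' h₁ h₂ => ?_⟩
  exact mk_mul_unique (hx.quot_eq.symm.trans h₁) (hy.quot_eq.symm.trans h₂)

/-- The product is the element `z` such that `z = (T, a b, U)` whenever `x = (T, a, S)` and
`y = (S, b, U)`, that is, whenever `x` and `y` are represented by diagrams that can be stacked.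
Such representatives exist, by `exists_match`. -/
noncomputable instance : Mul Vbr := ⟨fun x y => (exists_product x y).choose⟩

theorem Vbr.mk_mul_mk {n : ℕ} (T S U : LeafTree n) (a b : Braid n) :
    Vbr.mk T a S * Vbr.mk S b U = Vbr.mk T (a * b) U :=
  (exists_product (Vbr.mk T a S) (Vbr.mk S b U)).choose_spec n T S U a b rfl rfl

/-- The identity is represented by a pair of trivial trees. -/
instance : One Vbr := ⟨Vbr.mk (n := 1) ⟨.nil, rfl⟩ 1 ⟨.nil, rfl⟩⟩

/-- The inverse of `(T, b, S)` is `(S, b⁻¹, T)`. -/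
def Diagram.flip (x : Diagram) : Diagram := ⟨x.n, x.bot, x.braid⁻¹, x.top⟩

instance : Inv Vbr := ⟨Quot.map Diagram.flip (by
  rintro ⟨n, T, b, S⟩ _ ⟨k, rfl⟩
  refine ⟨rho b k, ?_⟩
  have h : rho b⁻¹ (rho b k) = k := by simp
  have h' : (clone k b)⁻¹ = clone (rho b k) b⁻¹ := by simp [clone_inv]
  change Diagram.mk (n + 1) (S.addCaret k) (clone k b)⁻¹ (T.addCaret (rho b k)) =
    Diagram.mk (n + 1) (S.addCaret (rho b⁻¹ (rho b k))) (clone (rho b k) b⁻¹)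
      (T.addCaret (rho b k))
  rw [h, h'])⟩

theorem Vbr.inv_mk {n : ℕ} (T S : LeafTree n) (b : Braid n) :
    (Vbr.mk T b S)⁻¹ = Vbr.mk S b⁻¹ T := rfl

theorem Vbr.mk_one {n : ℕ} (T : LeafTree n) : Vbr.mk T 1 T = 1 := by
  obtain ⟨X, hX, hT⟩ := exists_expands_bot ⟨1, ⟨.nil, rfl⟩, 1, ⟨.nil, rfl⟩⟩ T.1 trivial
  have key : ∀ X, Expands ⟨1, ⟨.nil, rfl⟩, 1, ⟨.nil, rfl⟩⟩ X →
      ∃ (m : ℕ) (S : LeafTree m), X = ⟨m, S, 1, S⟩ := by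
    intro X hX
    induction hX with
    | refl => exact ⟨_, _, rfl⟩
    | tail _ h ih =>
      obtain ⟨m, S, rfl⟩ := ih
      obtain ⟨k, rfl⟩ := h
      exact ⟨m + 1, S.addCaret k, by simp [Diagram.expand, clone_one]⟩
  obtain ⟨m, S, rfl⟩ := key X hX
  obtain rfl : m = n := by rw [← S.2, ← T.2]; exact congrArg _ hT
  obtain rfl : S = T := Subtype.ext hT
  exact hX.quot_eq.symm

/-- The braided Thompson group. -/
noncomputable instance : Group Vbr :=
  Group.ofLeftAxioms
    (by
      intro x y z
      induction x using Quot.ind with | _ x =>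
      induction y using Quot.ind with | _ y =>
      induction z using Quot.ind with | _ z =>
      obtain ⟨m, S, U, W, b, c, hy, hz⟩ := exists_match y z
      obtain ⟨l, T', S', U', a', b', hx, hy'⟩ := exists_match x ⟨m, S, b, U⟩
      obtain ⟨⟨l', U₂, c', W'⟩, hW⟩ : ∃ Z, Expands ⟨m, U, c, W⟩ Z ∧ Z.top.1 = U'.1 :=
        exists_expands_top _ _ hy'.bot_le
      obtain rfl : l' = l := by rw [← U₂.2, ← U'.2]; exact congrArg _ hW.2
      obtain rfl : U₂ = U' := Subtype.ext hW.2
      rw [hx.quot_eq, Expands.quot_eq (hy.trans hy'), Expands.quot_eq (hz.trans hW.1)]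
      change Vbr.mk T' a' S' * Vbr.mk S' b' U₂ * Vbr.mk U₂ c' W' =
        Vbr.mk T' a' S' * (Vbr.mk S' b' U₂ * Vbr.mk U₂ c' W')
      simp only [Vbr.mk_mul_mk, mul_assoc])
    (by
      intro x
      induction x using Quot.ind with | _ x =>
      obtain ⟨n, T, b, S⟩ := x
      change 1 * Vbr.mk T b S = Vbr.mk T b S
      rw [← Vbr.mk_one T, Vbr.mk_mul_mk, one_mul])
    (by
      intro x
      induction x using Quot.ind with | _ x =>
      obtain ⟨n, T, b, S⟩ := x
      change (Vbr.mk T b S)⁻¹ * Vbr.mk T b S = 1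
      rw [Vbr.inv_mk, Vbr.mk_mul_mk, inv_mul_cancel, Vbr.mk_one])

/-! ### The subgroups of pure braids -/

theorem mem_pureBraid {n : ℕ} {b : Braid n} : b ∈ PureBraid n ↔ rho b = 1 := MonoidHom.mem_ker

theorem clone_mem_pureBraid {n : ℕ} (k : Fin n) {b : Braid n} (hb : b ∈ PureBraid n) :
    clone k b ∈ PureBraid (n + 1) := by
  rw [mem_pureBraid] at hb ⊢
  have h₁ := rho_clone_left b k
  have h₂ := rho_clone_right b k
  have h₃ := rho_clone_shift b k
  simp only [hb, Equiv.Perm.one_apply] at h₁ h₂ h₃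
  ext1 m
  rw [Equiv.Perm.one_apply]
  have hm := m.isLt
  have hk := k.isLt
  rcases position_cases m.val k.val with h | h | h | h
  · have e : (shift k ⟨m.val, by omega⟩) = m := Fin.ext (shift_val_gt h)
    rw [← e]
    exact h₃ _ (by simp only [ne_eq, Fin.ext_iff]; omega)
  · have e : k.castSucc = m := Fin.ext h.symm
    rw [← e, h₁]
  · have e : k.succ = m := Fin.ext h.symm
    rw [← e, h₂]
  · have e : (shift k ⟨m.val - 1, by omega⟩) = m :=
      Fin.ext (by rw [shift_val_lt (show k.val < m.val - 1 by omega)]; simp only; omega)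
    rw [← e]
    exact h₃ _ (by simp only [ne_eq, Fin.ext_iff]; omega)

/-- The cloning map `κ_k : PBₙ → PBₙ₊₁`, a homomorphism. -/
def pureClone {n : ℕ} (k : Fin n) : PureBraid n →* PureBraid (n + 1) where
  toFun p := ⟨clone k p.1, clone_mem_pureBraid k p.2⟩
  map_one' := Subtype.ext (clone_one k)
  map_mul' p q := Subtype.ext (by
    have := mem_pureBraid.1 q.2
    simp [clone_mul, this])

theorem Expands.pure {x y : Diagram} (h : Expands x y) (hx : x.braid ∈ PureBraid x.n) :
    y.braid ∈ PureBraid y.n := by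
  induction h with
  | refl => exact hx
  | tail _ h ih =>
    obtain ⟨k, rfl⟩ := h
    exact clone_mem_pureBraid k ih

theorem Expands.pure_diag {x y : Diagram} (h : Expands x y) (hx : x.braid ∈ PureBraid x.n)
    (hx' : x.top = x.bot) : y.top = y.bot := by
  induction h with
  | refl => exact hx'
  | tail h' h ih =>
    have hp := mem_pureBraid.1 (Expands.pure h' hx)
    obtain ⟨k, rfl⟩ := h
    simp only [Diagram.expand, hp, ih, Equiv.Perm.one_apply]

/-- The group of the elements `(T, p, S)` with a pure braid `p`. -/
noncomputable def Fbr : Subgroup Vbr where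
  carrier := {g | ∃ (n : ℕ) (T S : LeafTree n) (p : Braid n),
    p ∈ PureBraid n ∧ g = Vbr.mk T p S}
  one_mem' := ⟨1, _, _, 1, one_mem _, rfl⟩
  mul_mem' := by
    rintro _ _ ⟨n, T, S, p, hp, rfl⟩ ⟨n', T', S', p', hp', rfl⟩
    obtain ⟨m, T₂, S₂, U₂, a, b, h₁, h₂⟩ := exists_match ⟨n, T, p, S⟩ ⟨n', T', p', S'⟩
    refine ⟨m, T₂, U₂, a * b, mul_mem (h₁.pure hp) (h₂.pure hp'), ?_⟩
    rw [← Vbr.mk_mul_mk T₂ S₂ U₂]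
    exact congrArg₂ _ h₁.quot_eq h₂.quot_eq
  inv_mem' := by
    rintro _ ⟨n, T, S, p, hp, rfl⟩
    exact ⟨n, S, T, p⁻¹, inv_mem hp, rfl⟩

/-- The group of the elements `(T, p, T)` with a pure braid `p`. -/
noncomputable def Pbr : Subgroup Vbr where
  carrier := {g | ∃ (n : ℕ) (T : LeafTree n) (p : Braid n), p ∈ PureBraid n ∧ g = Vbr.mk T p T}
  one_mem' := ⟨1, _, 1, one_mem _, rfl⟩
  mul_mem' := by
    rintro _ _ ⟨n, T, p, hp, rfl⟩ ⟨n', T', p', hp', rfl⟩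
    obtain ⟨m, T₂, S₂, U₂, a, b, h₁, h₂⟩ := exists_match ⟨n, T, p, T⟩ ⟨n', T', p', T'⟩
    obtain rfl : T₂ = S₂ := h₁.pure_diag hp rfl
    obtain rfl : T₂ = U₂ := h₂.pure_diag hp' rfl
    refine ⟨m, T₂, a * b, mul_mem (h₁.pure hp) (h₂.pure hp'), ?_⟩
    rw [← Vbr.mk_mul_mk T₂ T₂ T₂]
    exact congrArg₂ _ h₁.quot_eq h₂.quot_eq
  inv_mem' := by
    rintro _ ⟨n, T, p, hp, rfl⟩
    exact ⟨n, T, p⁻¹, inv_mem hp, rfl⟩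

/-- The canonical morphism `ι_{n,T} : PBₙ → Pbr`, `p ↦ (T, p, T)`. -/
noncomputable def iota {n : ℕ} (T : LeafTree n) : PureBraid n →* Pbr where
  toFun p := ⟨Vbr.mk T p.1 T, n, T, p.1, p.2, rfl⟩
  map_one' := Subtype.ext (Vbr.mk_one T)
  map_mul' p q := Subtype.ext (Vbr.mk_mul_mk T T T p.1 q.1).symm

/-! ### Families of subgroups -/

/-- An ordered union of carets `Φ = λ_{k₁} ∪ ⋯ ∪ λ_{kᵣ}`, a forest with `n` roots and `m = n + r`
leaves. -/
inductive CaretSeq : ℕ → ℕ → Type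
  | nil (n : ℕ) : CaretSeq n n
  | cons {n m : ℕ} (k : Fin n) (Φ : CaretSeq (n + 1) m) : CaretSeq n m

/-- The tree `T ∪ Φ`. The trees above `T` in the directed system are those of this form. -/
def LeafTree.attach {n m : ℕ} (T : LeafTree n) : CaretSeq n m → LeafTree m
  | .nil _ => T
  | .cons k Φ => (T.addCaret k).attach Φ

/-- The iterated cloning map `κ_Φ = κ_{kᵣ} ∘ ⋯ ∘ κ_{k₁}` on pure braids. -/
def CaretSeq.pureClone {n m : ℕ} : CaretSeq n m → PureBraid n →* PureBraid m
  | .nil _ => MonoidHom.id _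
  | .cons k Φ => Φ.pureClone.comp (BraidedThompson.pureClone k)

/-- A family of subgroups `G_{n,T} ≤ PB_{n,T}`, where `PB_{n,T}` is the copy of `PBₙ` indexed by
the tree `T` with `n` leaves. -/
abbrev PureFamily : Type := ∀ n : ℕ, LeafTree n → Subgroup (PureBraid n)

/-- `κ(G_{n,T}) ⊆ G_{n',T'}` for all `(n, T) ≤ (n', T')`. -/
def PureFamily.Coherent (G : PureFamily) : Prop :=
  ∀ (n m : ℕ) (T : LeafTree n) (Φ : CaretSeq n m),
    (G n T).map Φ.pureClone ≤ G m (T.attach Φ)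

/-- The family is coherent and `κ⁻¹(G_{n',T'}) = G_{n,T}` for all `(n, T) ≤ (n', T')`. -/
def PureFamily.CompleteCoherent (G : PureFamily) : Prop :=
  G.Coherent ∧ ∀ (n m : ℕ) (T : LeafTree n) (Φ : CaretSeq n m),
    (G m (T.attach Φ)).comap Φ.pureClone = G n T

/-- The subgroup of `Pbr` that is generated by all the `ι_{n,T}(G_{n,T})`. -/
noncomputable def PureFamily.generated (G : PureFamily) : Subgroup Pbr :=
  Subgroup.closure (⋃ (n : ℕ) (T : LeafTree n), iota T '' (G n T : Set (PureBraid n)))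

/-- The subgroup `G_Th` of `Pbr` that corresponds to a sequence of subgroups `Gₙ ≤ PBₙ`. -/
noncomputable def thompsonLimit (G : ∀ n : ℕ, Subgroup (PureBraid n)) : Subgroup Pbr :=
  PureFamily.generated fun n _ => G n

/-- A subgroup of `Pbr` is normal in `Fbr`. -/
def NormalInFbr (N : Subgroup Pbr) : Prop := ((N.map Pbr.subtype).subgroupOf Fbr).Normal

/-- A subgroup of `Pbr` is normal in the whole braided Thompson group. -/
def NormalInVbr (N : Subgroup Pbr) : Prop := (N.map Pbr.subtype).Normal

theorem Pbr_le_Fbr : Pbr ≤ Fbr := by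
  rintro _ ⟨n, T, p, hp, rfl⟩
  exact ⟨n, T, T, p, hp, rfl⟩

end BraidedThompson

/-! Everything rests on one computation: conjugating `(S, q, S)` by `(A, b, S)` gives `(A, b q b⁻¹,
A)`. Conjugation thus replaces the tree by any other with the same number of leaves and conjugates
the braid. After expansion every pair consisting of a group element and a member of the family can
be brought into this position, and coherence keeps the expanded braid in the family.

Coherence makes the subgroup generated by the family a directed union: its elements are exactly the
`(T, p, T)` with `p` in `G n T` (`PureFamily.Coherent.mem_generated`). Completeness makes membership
readable from any diagonal pure representative
(`PureFamily.CompleteCoherent.iota_mem_generated_iff`). If the members are normal and independent of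
the tree, the computation shows that conjugates stay in the union; conversely, conjugating by `(T,
b, S)` and reading off membership gives normality when `T = S` and independence of the tree when `b
= 1`. For the whole group `b` is an arbitrary braid, so normality in `Bₙ` takes the place of
normality in `PBₙ`.

Two auxiliary facts are needed. An element of `Fbr` has a pure braid in each of its representatives,
because cloning reflects purity (`mem_pureBraid_of_clone`). Cloning is also injective, since
removing one of the two parallel strands undoes it; this turns the condition on intersections with
the image of `κ_k` into one on preimages, which is completeness. -/

namespace BraidedThompson

/-! ### Forgetting a strand -/

/-- The braid on `n` strands obtained from the generator `σᵢ` of `Bₙ₊₁` by removing the strand which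
is in the position `k` at the bottom. -/
def forgetGen (n k i : ℕ) : Braid n :=
  if k < i then gen n (i - 1) else if i + 1 < k then gen n i else 1

theorem forgetGen_lt {n i k : ℕ} (h : k < i) : forgetGen n k i = gen n (i - 1) := if_pos h

theorem forgetGen_gt {n i k : ℕ} (h : i + 1 < k) : forgetGen n k i = gen n i := by
  unfold forgetGen; rw [if_neg (by omega), if_pos h]

theorem forgetGen_self {n i : ℕ} : forgetGen n i i = 1 := by
  unfold forgetGen; rw [if_neg (by omega), if_neg (by omega)]

theorem forgetGen_succ {n i k : ℕ} (h : k = i + 1) : forgetGen n k i = 1 := by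
  unfold forgetGen; rw [if_neg (by omega), if_neg (by omega)]

/-- This relation and `forgetGen_braid` are the Artin relations for the crossed rule `φ_k(a b) =
φ_{ρ_b(k)}(a) φ_k(b)`: the removed strand is followed upwards through the word. They make
`forgetAct` well defined. -/
theorem forgetGen_far {n i j : ℕ} (k : ℕ) (h : i + 2 ≤ j) :
    forgetGen n (swapNat j k) i * forgetGen n k j =
      forgetGen n (swapNat i k) j * forgetGen n k i := by
  rcases position_cases k i with hk | rfl | rfl | hk
  · simp (disch := omega) only [swapNat_lt, forgetGen_lt]
    exact gen_comm (by omega)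
  · simp (disch := omega) only [swapNat_lt, swapNat_self, forgetGen_lt, forgetGen_self, one_mul,
      mul_one]
  · simp (disch := omega) only [swapNat_lt, swapNat_succ, forgetGen_lt, forgetGen_succ, one_mul,
      mul_one]
  · rcases position_cases k j with hk' | rfl | rfl | hk'
    · simp (disch := omega) only [swapNat_lt, swapNat_gt, forgetGen_gt, forgetGen_lt]
      exact gen_comm (by omega)
    · simp (disch := omega) only [swapNat_self, swapNat_gt, forgetGen_gt, forgetGen_self, one_mul,
        mul_one]
    · simp (disch := omega) only [swapNat_succ, swapNat_gt, forgetGen_gt, forgetGen_succ, one_mul,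
        mul_one]
    · simp (disch := omega) only [swapNat_gt, forgetGen_gt]
      exact gen_comm h

theorem forgetGen_braid {n i k : ℕ} (hk : k ≤ n) (h : i + 2 ≤ n) :
    forgetGen n (swapNat (i + 1) (swapNat i k)) i * forgetGen n (swapNat i k) (i + 1) *
        forgetGen n k i =
      forgetGen n (swapNat i (swapNat (i + 1) k)) (i + 1) * forgetGen n (swapNat (i + 1) k) i *
        forgetGen n k (i + 1) := by
  rcases position_cases k i with hk | rfl | rfl | hk
  · simp (disch := omega) only [swapNat_lt, forgetGen_lt]
    -- Since `k < i`, the index `i` is positive, and the remaining strands satisfy the braid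
    -- relation of `σᵢ₋₁` and `σᵢ`.
    obtain ⟨i, rfl⟩ : ∃ j, i = j + 1 := ⟨i - 1, by omega⟩
    exact gen_braid (by omega)
  · simp (disch := omega) only [swapNat_lt, swapNat_self, forgetGen_gt, forgetGen_lt,
      forgetGen_self, one_mul, mul_one, Nat.add_sub_cancel]
  · simp (disch := omega) only [swapNat_lt, swapNat_self, swapNat_succ, swapNat_gt, forgetGen_gt,
      forgetGen_lt, forgetGen_self, forgetGen_succ, one_mul, mul_one, Nat.add_sub_cancel]
  · rcases eq_or_lt_of_le (show i + 1 + 1 ≤ k from hk) with rfl | hk'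
    · simp (disch := omega) only [swapNat_succ, swapNat_gt, forgetGen_gt, forgetGen_lt,
        forgetGen_succ, one_mul, mul_one, Nat.add_sub_cancel]
    · simp (disch := omega) only [swapNat_gt, forgetGen_gt]
      -- The removed strand lies to the right of all three crossing strands, so `i + 2 < k ≤ n`
      -- leaves room for the relation in `Bₙ`.
      exact gen_braid (by omega)

/-- The permutation `(g, k) ↦ (φ_k(σᵢ) g, ρ_{σᵢ}(k))` of `Bₙ × {0, …, n}`, where `φ_k` removes the
strand in the position `k`. -/
def forgetActGen {n : ℕ} (i : Fin (n + 1 - 1)) : Equiv.Perm (Braid n × Fin (n + 1)) where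
  toFun x := (forgetGen n x.2.val i.val * x.1, adjSwap i x.2)
  invFun x := ((forgetGen n (adjSwap i x.2).val i.val)⁻¹ * x.1, adjSwap i x.2)
  left_inv x := by simp [adjSwap]
  right_inv x := by simp [adjSwap]

/-- The action `b • (g, k) = (φ_k(b) g, ρ_b(k))` of `Bₙ₊₁` on `Bₙ × {0, …, n}` through which the
removal of a strand is defined. -/
def forgetAct {n : ℕ} : Braid (n + 1) →* Equiv.Perm (Braid n × Fin (n + 1)) :=
  braidLift forgetActGen
    (by
      intro i j hij
      ext1 x
      refine Prod.ext ?_ (DFunLike.congr_fun (adjSwap_far i j hij) x.2)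
      have := forgetGen_far (n := n) x.2.val hij
      simp only [Equiv.Perm.mul_apply, forgetActGen, Equiv.coe_fn_mk, adjSwap_val]
      rw [← mul_assoc, ← mul_assoc, this])
    (by
      intro i j hij
      ext1 x
      refine Prod.ext ?_ (DFunLike.congr_fun (adjSwap_braid i j hij) x.2)
      have := forgetGen_braid (n := n) (i := i.val) (k := x.2.val) (by omega) (by omega)
      simp only [Equiv.Perm.mul_apply, forgetActGen, Equiv.coe_fn_mk, adjSwap_val, ← hij]
      rw [← mul_assoc, ← mul_assoc, ← mul_assoc, ← mul_assoc, this])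

theorem forgetAct_gen {n i : ℕ} (h : i < n) (g : Braid n) (k : Fin (n + 1)) :
    forgetAct (gen (n + 1) i) (g, k) =
      (forgetGen n k.val i * g, rho (gen (n + 1) i) k) := by
  rw [gen_eq_of (n := n + 1) ⟨i, h⟩, forgetAct, rho, braidLift_of, braidLift_of]
  rfl

theorem forgetAct_clone_gen {n i : ℕ} (h : i < n - 1) (g : Braid n) (k : Fin n) :
    forgetAct (clone k (gen n i)) (g, k.castSucc) =
      (gen n i * g, (rho (gen n i) k).castSucc) := by
  rw [← rho_clone_left, clone_gen' k h]
  have hn : i < n := by omega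
  have hn' : i + 1 < n + 1 - 1 := by omega
  have hn'' : i < n + 1 - 1 := by omega
  rcases position_cases k.val i with hk | hk | hk | hk
  · rw [cloneGen_lt hk, forgetAct_gen (by omega), Fin.val_castSucc, forgetGen_lt (by omega),
      Nat.add_sub_cancel]
  -- Words act from the right. The factor `σᵢ₊₁` misses the removed strand in position `i` and
  -- becomes `σᵢ`; the factor `σᵢ` then involves that strand and disappears. In the next case the
  -- lower factor disappears instead.
  · rw [hk, cloneGen_self, map_mul, map_mul, Equiv.Perm.mul_apply, Equiv.Perm.mul_apply,
      forgetAct_gen hn, forgetAct_gen (by omega), rho_gen_val hn', Fin.val_castSucc, hk,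
      swapNat_lt i.lt_succ_self, forgetGen_self, forgetGen_lt i.lt_succ_self, one_mul]
    rfl
  · rw [hk, cloneGen_succ rfl, map_mul, map_mul, Equiv.Perm.mul_apply, Equiv.Perm.mul_apply,
      forgetAct_gen (by omega), forgetAct_gen hn, rho_gen_val hn'', Fin.val_castSucc, hk,
      swapNat_succ rfl, forgetGen_lt i.lt_succ_self, forgetGen_succ rfl, one_mul]
    rfl
  · rw [cloneGen_gt hk, forgetAct_gen hn, Fin.val_castSucc, forgetGen_gt hk]

/-- Removing the left one of the two strands that arise from a bifurcation undoes it. -/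
theorem forgetAct_clone {n : ℕ} (b : Braid n) : ∀ (g : Braid n) (k : Fin n),
    forgetAct (clone k b) (g, k.castSucc) = (b * g, (rho b k).castSucc) := by
  induction b using braid_induction with
  | one => simp [clone_one]
  | hgen i hi => exact forgetAct_clone_gen hi
  | mul a b ha hb =>
    intro g k
    rw [clone_mul, map_mul, Equiv.Perm.mul_apply, hb, ha, map_mul, Equiv.Perm.mul_apply, mul_assoc]
  | inv a ha =>
    intro g k
    rw [clone_inv, map_inv, Equiv.Perm.inv_eq_iff_eq, map_inv, ha]
    simp

/-- By `forgetAct_clone`, the braid is recovered as the first component of the action of its clone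
on `(1, k.castSucc)`. -/
theorem clone_injective {n : ℕ} (k : Fin n) : Function.Injective (clone (n := n) k) := by
  intro a b h
  have := (forgetAct_clone a 1 k).symm.trans (h ▸ forgetAct_clone b 1 k)
  simpa using congrArg Prod.fst this

theorem pureClone_injective {n : ℕ} (k : Fin n) :
    Function.Injective (pureClone (n := n) k) := fun _ _ h =>
  Subtype.ext (clone_injective k (congrArg Subtype.val h))

/-! ### The subgroup generated by a coherent family -/

/-- A pure braid fixes every position, so each expansion attaches a caret to the same leaf number in
both trees, and the cloned braid is again pure. Expansions of pure diagrams are therefore the arrows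
of the directed system. -/
theorem Expands.exists_caretSeq {x y : Diagram} (h : Expands x y) :
    ∀ {n : ℕ} (T S : LeafTree n) (p : PureBraid n), x = ⟨n, T, p.1, S⟩ →
      ∃ (m : ℕ) (Φ : CaretSeq n m),
        y = ⟨m, T.attach Φ, (Φ.pureClone p).1, S.attach Φ⟩ := by
  induction h using Relation.ReflTransGen.head_induction_on with
  | refl => exact fun T S p hx => ⟨_, .nil _, hx⟩
  | head hx _ ih =>
    rintro n T S p rfl
    obtain ⟨k, rfl⟩ := hx
    have hk : rho p.1 k = k := by rw [mem_pureBraid.1 p.2, Equiv.Perm.one_apply]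
    obtain ⟨m, Φ, hy⟩ := ih (T.addCaret k) (S.addCaret k) (pureClone k p)
      (by simp only [Diagram.expand, hk]; rfl)
    exact ⟨m, .cons k Φ, hy⟩

/-- A diagram and an element of a member of a coherent family can be expanded until they can be
stacked, and the latter stays in the family. -/
theorem PureFamily.Coherent.exists_match {G : PureFamily} (hG : G.Coherent) (x : Vbr) {n : ℕ}
    (T : LeafTree n) {p : PureBraid n} (hp : p ∈ G n T) :
    ∃ (m : ℕ) (A S : LeafTree m) (b : Braid m) (q : PureBraid m), q ∈ G m S ∧
      x = Vbr.mk A b S ∧ iota T p = iota S q := by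
  induction x using Quot.ind with | _ x =>
  obtain ⟨m, A, S, U, b, c, hx, hy⟩ := BraidedThompson.exists_match x ⟨n, T, p.1, T⟩
  -- The expansion of `(T, p, T)` is again diagonal, so `S = U` and its braid is `κ_Φ(p)`, which
  -- coherence places in the family.
  obtain ⟨m', Φ, hΦ⟩ := hy.exists_caretSeq T T p rfl
  obtain rfl : m = m' := congrArg Diagram.n hΦ
  obtain ⟨rfl, rfl, rfl⟩ : S = T.attach Φ ∧ c = (Φ.pureClone p).1 ∧ U = T.attach Φ := by
    simpa using hΦ
  exact ⟨m, A, _, b, Φ.pureClone p, hG n m T Φ ⟨p, hp, rfl⟩, hx.quot_eq, Subtype.ext hy.quot_eq⟩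

theorem PureFamily.iota_mem_generated {G : PureFamily} {n : ℕ} (T : LeafTree n) {p : PureBraid n}
    (hp : p ∈ G n T) : iota T p ∈ G.generated :=
  Subgroup.subset_closure (Set.mem_iUnion₂.2 ⟨n, T, p, hp, rfl⟩)

/-- The images of the members form a directed union: two elements can be expanded over a common
tree, where coherence puts both braids in the same subgroup. -/
theorem PureFamily.Coherent.mem_generated {G : PureFamily} (hG : G.Coherent) {x : Pbr} :
    x ∈ G.generated ↔ ∃ (n : ℕ) (T : LeafTree n) (p : PureBraid n), p ∈ G n T ∧ x = iota T p := by
  constructor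
  · intro hx
    induction hx using Subgroup.closure_induction with
    | mem x hx =>
      obtain ⟨n, T, p, hp, rfl⟩ := Set.mem_iUnion₂.1 hx
      exact ⟨n, T, p, hp, rfl⟩
    | one => exact ⟨1, ⟨.nil, rfl⟩, 1, one_mem _, (map_one _).symm⟩
    | mul x y _ _ hx hy =>
      obtain ⟨n, T, p, hp, rfl⟩ := hx
      obtain ⟨n', T', p', hp', rfl⟩ := hy
      obtain ⟨m, T₂, S₂, U₂, a, b, h₁, h₂⟩ :=
        BraidedThompson.exists_match ⟨n, T, p.1, T⟩ ⟨n', T', p'.1, T'⟩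
      obtain ⟨m₁, Φ, hΦ⟩ := h₁.exists_caretSeq T T p rfl
      obtain rfl : m = m₁ := congrArg Diagram.n hΦ
      obtain ⟨m₂, Ψ, hΨ⟩ := h₂.exists_caretSeq T' T' p' rfl
      obtain rfl : m = m₂ := congrArg Diagram.n hΨ
      obtain ⟨rfl, rfl, rfl⟩ : T₂ = T.attach Φ ∧ a = (Φ.pureClone p).1 ∧ S₂ = T.attach Φ := by
        simpa using hΦ
      obtain ⟨hS, rfl, rfl⟩ : T.attach Φ = T'.attach Ψ ∧ b = (Ψ.pureClone p').1 ∧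
          U₂ = T'.attach Ψ := by
        simpa using hΨ
      -- Both diagrams are diagonal, so the tree along which they are stacked is the only tree left,
      -- and the product can be taken in one `G m`.
      rw [← hS] at h₂
      refine ⟨m, T.attach Φ, Φ.pureClone p * Ψ.pureClone p',
        mul_mem (hG _ _ T Φ ⟨p, hp, rfl⟩) (hS ▸ hG _ _ T' Ψ ⟨p', hp', rfl⟩), ?_⟩
      rw [map_mul]
      exact congrArg₂ _ (Subtype.ext h₁.quot_eq) (Subtype.ext h₂.quot_eq)
    | inv x _ hx =>
      obtain ⟨n, T, p, hp, rfl⟩ := hx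
      exact ⟨n, T, p⁻¹, inv_mem hp, (map_inv _ _).symm⟩
  · rintro ⟨n, T, p, hp, rfl⟩
    exact iota_mem_generated T hp

/-- If `(T, p, T) = (S, q, S)` with `q` in the family, a common expansion gives `κ_Φ(p) = κ_Ψ(q)`.
Coherence puts this braid in the family, and completeness pulls it back along `κ_Φ` to `p`. -/
theorem PureFamily.CompleteCoherent.iota_mem_generated_iff {G : PureFamily}
    (hG : G.CompleteCoherent) {n : ℕ} {T : LeafTree n} {p : PureBraid n} :
    iota T p ∈ G.generated ↔ p ∈ G n T := by
  refine ⟨fun h => ?_, iota_mem_generated T⟩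
  obtain ⟨m, S, q, hq, h⟩ := hG.1.mem_generated.1 h
  obtain ⟨z, hz₁, hz₂⟩ := (quot_eq_iff ⟨n, T, p.1, T⟩ ⟨m, S, q.1, S⟩).1 (congrArg Subtype.val h)
  obtain ⟨l, Φ, rfl⟩ := hz₁.exists_caretSeq T T p rfl
  obtain ⟨l', Ψ, hΨ⟩ := hz₂.exists_caretSeq S S q rfl
  obtain rfl : l = l' := congrArg Diagram.n hΨ
  obtain ⟨hT, hp, -⟩ : T.attach Φ = S.attach Ψ ∧ (Φ.pureClone p).1 = (Ψ.pureClone q).1 ∧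
      T.attach Φ = S.attach Ψ := by
    simpa using hΨ
  rw [← hG.2 n l T Φ, Subgroup.mem_comap, Subtype.ext hp, hT]
  exact hG.1 m l S Ψ ⟨q, hq, rfl⟩

/-! ### Conjugation and normality -/

theorem mk_conj_iota {n : ℕ} (A S : LeafTree n) (b : Braid n) (q : PureBraid n) :
    Vbr.mk A b S * (iota S q : Vbr) * (Vbr.mk A b S)⁻¹ = Vbr.mk A (b * q.1 * b⁻¹) A := by
  change Vbr.mk A b S * Vbr.mk S q.1 S * (Vbr.mk A b S)⁻¹ = _
  rw [Vbr.inv_mk, Vbr.mk_mul_mk, Vbr.mk_mul_mk]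

theorem iota_mem_map_generated {N : Subgroup Pbr} {n : ℕ} (T : LeafTree n) (p : PureBraid n) :
    Vbr.mk T p.1 T ∈ N.map Pbr.subtype ↔ iota T p ∈ N :=
  Subgroup.mem_map_iff_mem (f := Pbr.subtype) Pbr.subtype_injective (x := iota T p)

theorem normalInFbr_iff {N : Subgroup Pbr} : NormalInFbr N ↔
    ∀ x ∈ N, ∀ g ∈ Fbr, g * (x : Vbr) * g⁻¹ ∈ N.map Pbr.subtype := by
  constructor
  · intro h x hx g hg
    exact h.conj_mem ⟨x, Pbr_le_Fbr x.2⟩ ⟨x, hx, rfl⟩ ⟨g, hg⟩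
  · intro h
    refine ⟨?_⟩
    rintro x ⟨y, hy, hyx⟩ g
    have := h y hy g.1 g.2
    rwa [show (y : Vbr) = x from hyx] at this

theorem normalInVbr_iff {N : Subgroup Pbr} : NormalInVbr N ↔
    ∀ x ∈ N, ∀ g : Vbr, g * (x : Vbr) * g⁻¹ ∈ N.map Pbr.subtype := by
  constructor
  · intro h x hx g
    exact h.conj_mem x ⟨x, hx, rfl⟩ g
  · intro h
    refine ⟨?_⟩
    rintro _ ⟨y, hy, rfl⟩ g
    exact h y hy g

/-! ### Purity does not depend on the representative -/

/-- The left copy of strand `k` is fixed by the clone, hence `k` is fixed by `b`. Any other strand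
is then fixed because `shift k` is injective. -/
theorem mem_pureBraid_of_clone {n : ℕ} {k : Fin n} {b : Braid n}
    (h : clone k b ∈ PureBraid (n + 1)) : b ∈ PureBraid n := by
  rw [mem_pureBraid] at h ⊢
  have h₁ := rho_clone_left b k
  rw [h, Equiv.Perm.one_apply, Fin.castSucc_inj] at h₁
  ext1 j
  rw [Equiv.Perm.one_apply]
  by_cases hj : k = j
  · rw [← hj, ← h₁]
  · have h₂ := rho_clone_shift b k j hj
    rw [h, Equiv.Perm.one_apply, ← h₁] at h₂
    have h₃ : k ≠ rho b j := fun e => hj ((rho b).injective (h₁.symm.trans e))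
    have h₄ := congrArg Fin.val h₂
    unfold shift at h₄
    simp only [apply_ite Fin.val, Fin.val_succ, Fin.val_castSucc, Fin.lt_def] at h₄
    rw [ne_eq, Fin.ext_iff] at h₃
    rw [Fin.ext_iff] at hj ⊢
    grind

theorem Expands.pure_iff {x y : Diagram} (h : Expands x y) :
    x.braid ∈ PureBraid x.n ↔ y.braid ∈ PureBraid y.n := by
  refine ⟨h.pure, fun hy => ?_⟩
  induction h with
  | refl => exact hy
  | tail _ h ih =>
    obtain ⟨k, rfl⟩ := h
    exact ih (mem_pureBraid_of_clone hy)

/-- Two representatives have a common expansion, and purity passes both up and down along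
expansions. -/
theorem Vbr.mk_mem_Fbr_iff {n : ℕ} {T S : LeafTree n} {b : Braid n} :
    Vbr.mk T b S ∈ Fbr ↔ b ∈ PureBraid n := by
  refine ⟨?_, fun h => ⟨n, T, S, b, h, rfl⟩⟩
  rintro ⟨m, A, B, p, hp, h⟩
  obtain ⟨z, hz₁, hz₂⟩ := (quot_eq_iff ⟨n, T, b, S⟩ ⟨m, A, p, B⟩).1 h
  exact hz₁.pure_iff.2 (hz₂.pure hp)

/-! ### Normality in `Fbr` -/

/-- Coherence suffices in this direction: the conjugate is exhibited as an element of the union, and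
no membership has to be pulled back. -/
theorem PureFamily.Coherent.normalInFbr {G : PureFamily} (hG : G.Coherent)
    (hN : ∀ (n : ℕ) (T : LeafTree n), (G n T).Normal)
    (hT : ∀ (n : ℕ) (T S : LeafTree n), G n T = G n S) : NormalInFbr G.generated := by
  rw [normalInFbr_iff]
  intro x hx g hg
  obtain ⟨n, T, p, hp, rfl⟩ := hG.mem_generated.1 hx
  obtain ⟨m, A, S, b, q, hq, rfl, h⟩ := hG.exists_match g T hp
  lift b to PureBraid m using Vbr.mk_mem_Fbr_iff.1 hg
  rw [h, mk_conj_iota]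
  refine (iota_mem_map_generated A (b * q * b⁻¹)).2 (iota_mem_generated A ?_)
  exact (hN m A).conj_mem q (hT m S A ▸ hq) b

theorem PureFamily.CompleteCoherent.normalInFbr_iff {G : PureFamily} (hG : G.CompleteCoherent) :
    NormalInFbr G.generated ↔ (∀ (n : ℕ) (T : LeafTree n), (G n T).Normal) ∧
      ∀ (n : ℕ) (T S : LeafTree n), G n T = G n S := by
  refine ⟨fun h => ?_, fun h => hG.1.normalInFbr h.1 h.2⟩
  rw [BraidedThompson.normalInFbr_iff] at h
  -- Conjugation by the single element `(T, b, S)` yields both conditions: `T = S` gives normality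
  -- and `b = 1` gives the inclusion of `G n S` in `G n T`.
  have key : ∀ (n : ℕ) (T S : LeafTree n) (b q : PureBraid n), q ∈ G n S →
      b * q * b⁻¹ ∈ G n T := by
    intro n T S b q hq
    have := h _ (iota_mem_generated S hq) (Vbr.mk T b.1 S) ⟨n, T, S, b.1, b.2, rfl⟩
    rw [mk_conj_iota] at this
    exact hG.iota_mem_generated_iff.1 ((iota_mem_map_generated T (b * q * b⁻¹)).1 this)
  have le : ∀ (n : ℕ) (T S : LeafTree n), G n S ≤ G n T := fun n T S q hq => by
    simpa using key n T S 1 q hq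
  exact ⟨fun n T => ⟨fun q hq b => key n T T b q hq⟩, fun n T S => (le n S T).antisymm (le n T S)⟩

/-! ### Sequences of subgroups -/

section Sequences

variable {G : ∀ n : ℕ, Subgroup (PureBraid n)}

theorem coherent_const (hG : ∀ (n : ℕ) (k : Fin n), (G n).map (pureClone k) ≤ G (n + 1)) :
    PureFamily.Coherent fun n _ => G n := by
  intro n m T Φ
  change (G n).map Φ.pureClone ≤ G m
  -- The claim no longer mentions the tree, whose type depends on the index `n` that varies in the
  -- induction.
  clear T
  induction Φ with
  | nil n => exact (Subgroup.map_id _).le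
  | cons k Φ ih =>
    rw [CaretSeq.pureClone, ← Subgroup.map_map]
    exact (Subgroup.map_mono (hG _ k)).trans ih

theorem completeCoherent_const
    (hG : ∀ (n : ℕ) (k : Fin n), (G (n + 1)).comap (pureClone k) = G n) :
    PureFamily.CompleteCoherent fun n _ => G n := by
  refine ⟨coherent_const fun n k => Subgroup.map_le_iff_le_comap.2 (hG n k).ge, ?_⟩
  intro n m T Φ
  change (G m).comap Φ.pureClone = G n
  clear T
  induction Φ with
  | nil n => exact Subgroup.comap_id _
  | cons k Φ ih => rw [CaretSeq.pureClone, ← Subgroup.comap_comap, ih, hG]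

/-- The image of the preimage is the intersection with the range, so the hypothesis equates two
images under `κ_k`, and injectivity cancels it. -/
theorem comap_pureClone_of_range_inf {n : ℕ} {k : Fin n}
    (h : (pureClone k).range ⊓ G (n + 1) = (G n).map (pureClone k)) :
    (G (n + 1)).comap (pureClone k) = G n := by
  apply Subgroup.map_injective (pureClone_injective k)
  rw [Subgroup.map_comap_eq, h]

theorem LeafTree.nonempty (n : ℕ) : Nonempty (LeafTree (n + 1)) := by
  induction n with
  | zero => exact ⟨⟨.nil, rfl⟩⟩
  | succ n ih => exact ih.map fun T => T.addCaret 0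

/-- No tree has `0` leaves, so normality of the limit says nothing about `G 0`; that case holds
because `B₀` is trivial. -/
instance : Subsingleton (Braid 0) := by
  refine subsingleton_of_forall_eq 1 fun b => ?_
  induction b using braid_induction with
  | one => rfl
  | hgen i hi => exact absurd hi (by omega)
  | mul a b ha hb => rw [ha, hb, mul_one]
  | inv a ha => rw [ha, inv_one]

theorem normalInVbr_thompsonLimit
    (hG : ∀ (n : ℕ) (k : Fin n), (G (n + 1)).comap (pureClone k) = G n) :
    NormalInVbr (thompsonLimit G) ↔ ∀ n : ℕ, ((G n).map (PureBraid n).subtype).Normal := by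
  have hC := completeCoherent_const hG
  rw [normalInVbr_iff]
  constructor
  · intro h n
    refine ⟨?_⟩
    rintro _ ⟨q, hq, rfl⟩ b
    rcases n with _ | n
    · rw [Subsingleton.elim (_ * _ * _) (1 : Braid 0)]
      exact one_mem _
    obtain ⟨T⟩ := LeafTree.nonempty n
    -- `PBₙ` is a kernel, so the conjugate by an arbitrary braid is still pure and its membership in
    -- the limit can be read off over `T`.
    have hb : b * q.1 * b⁻¹ ∈ PureBraid (n + 1) :=
      (MonoidHom.normal_ker rho).conj_mem q.1 q.2 b
    have := h _ (PureFamily.iota_mem_generated T hq) (Vbr.mk T b T)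
    rw [mk_conj_iota] at this
    exact ⟨⟨_, hb⟩, hC.iota_mem_generated_iff.1 ((iota_mem_map_generated T ⟨_, hb⟩).1 this), rfl⟩
  · intro h x hx g
    obtain ⟨n, T, p, hp, rfl⟩ := hC.1.mem_generated.1 hx
    obtain ⟨m, A, S, b, q, hq, rfl, hpq⟩ := hC.1.exists_match g T hp
    -- Here `b` need not be pure; normality in the full braid group supplies a pure braid `r` in `G
    -- m` equal to `b q b⁻¹`. The change of tree from `S` to `A` is harmless because `G m` is the
    -- same over both.
    obtain ⟨r, hr, hrq⟩ := (h m).conj_mem q.1 ⟨q, hq, rfl⟩ b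
    rw [hpq, mk_conj_iota, ← hrq]
    exact (iota_mem_map_generated A r).2 (PureFamily.iota_mem_generated A hr)

end Sequences

end BraidedThompson

theorem lemma4p2 :
    (∀ G : BraidedThompson.PureFamily, G.CompleteCoherent →
      (BraidedThompson.NormalInFbr G.generated ↔
        (∀ (n : ℕ) (T : BraidedThompson.LeafTree n), (G n T).Normal) ∧
          ∀ (n : ℕ) (T S : BraidedThompson.LeafTree n), G n T = G n S)) ∧
    (∀ G : (n : ℕ) → Subgroup (BraidedThompson.PureBraid n),
      (∀ (n : ℕ) (k : Fin n), (BraidedThompson.pureClone k).range ⊓ G (n + 1) =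
        (G n).map (BraidedThompson.pureClone k)) →
      ((∀ n : ℕ, (G n).Normal) →
        BraidedThompson.NormalInFbr (BraidedThompson.thompsonLimit G)) ∧
      (BraidedThompson.NormalInVbr (BraidedThompson.thompsonLimit G) ↔
        ∀ n : ℕ, ((G n).map (BraidedThompson.PureBraid n).subtype).Normal)) := by
  refine ⟨fun G hG => hG.normalInFbr_iff, fun G hG => ⟨fun hN => ?_, ?_⟩⟩
  -- The image of `G n` is an intersection with `G (n + 1)`, hence contained in it, which is
  -- coherence for one caret.
  · exact (BraidedThompson.coherent_const fun n k =>
      (hG n k).ge.trans inf_le_right).normalInFbr (fun n _ => hN n) fun _ _ _ => rfl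
  · exact BraidedThompson.normalInVbr_thompsonLimit fun n k =>
      BraidedThompson.comap_pureClone_of_range_inf (hG n k)
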